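/- A multi-agent contract setting with $n$ agents consists of a value function $f:2^{[n]}\to\mathbb R_+$ that is monotone with $f(\emptyset)=0$, and individual costs $c_1,\dots,c_n$ with $0<c_i\le f(\{i\})$ for every $i$. Write $f(i:S)=f(S\cup\{i\})-f(S\setminus\{i\})$. The function $f$ is submodular if $f(i:S)\ge f(i:S\cup\{j\})$ for all $S\subseteq[n]$ and $i,j\in[n]\setminus S$. For $S\subseteq[n]$ let $w(S)=f(S)-\sum_{i\in S}c_i$ be the welfare, let $\rho(S)=\sum_{i\in S}c_i/f(i:S)$ be the minimum total share needed to incentivize $S$ (with $\rho(S)=\infty$ if $f(i:S)=0$ for some $i\in S$), and let $g(S)=(1-\rho(S))f(S)$ be the principal's utility. A set $S$ is feasible if $\rho(S)\le 1$, and $\mathrm{OPT}(w)=\max\{w(S): S\subseteq[n],\ \rho(S)\le 1\}$. There is a single algorithm that, for every $n$ and every setting $(f,c)$ with $n$ agents and a submodular value function $f$, given $n$ and $c_1,\dots,c_n$ as input and access to $f$ through value queries only (a query specifies a set $S\subseteq[n]$ and returns the number $f(S)$), runs in time polynomial in $n$ and outputs a feasible set $S$ whose utility satisfies $$g(S)\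 \ge\ \tfrac{1}{468}\,\mathrm{OPT}(w).$$ Here the algorithm is a program for a real RAM with a value oracle, and time is the number of its steps, where additions, subtractions, multiplications, divisions and comparisons of real numbers are exact and have unit cost and a query has cost $n+1$. -/

import Mathlib

namespace TeamContracts

/-! ### Multi-agent contract settings -/

/-- The marginal contribution `f(i : S) = f(S ∪ {i}) - f(S \ {i})`. -/
def marginal {n : ℕ} (f : Finset (Fin n) → ℝ) (i : Fin n) (S : Finset (Fin n)) : ℝ :=
  f (insert i S) - f (S.erase i)

/-- A multi-agent contract setting with `n` agents: a monotone normalized value function and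
strictly positive individual costs, where every single agent has a positive value that is at
least the agent's cost. -/
structure Setting (n : ℕ) where
  f : Finset (Fin n) → ℝ
  c : Fin n → ℝ
  f_mono : Monotone f
  f_empty : f ∅ = 0
  f_single_pos : ∀ i, 0 < f {i}
  c_pos : ∀ i, 0 < c i
  c_le : ∀ i, c i ≤ f {i}

/-- Submodularity: marginal contributions do not increase when an agent is added. -/
def Submodular {n : ℕ} (f : Finset (Fin n) → ℝ) : Prop :=
  ∀ (S : Finset (Fin n)) (i j : Fin n), i ∉ S → j ∉ S →
    marginal f i (insert j S) ≤ marginal f i S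

namespace Setting

variable {n : ℕ} (I : Setting n)

/-- Welfare `w(S) = f(S) - c(S)`. -/
noncomputable def welfare (S : Finset (Fin n)) : ℝ := I.f S - ∑ i ∈ S, I.c i

/-- The minimum total share `ρ(S) = ∑ i ∈ S, c i / f(i : S)` needed to incentivize `S`.
It is meaningful (finite) only if all the marginal contributions in `S` are positive. -/
noncomputable def share (S : Finset (Fin n)) : ℝ := ∑ i ∈ S, I.c i / marginal I.f i S

/-- Feasibility (budget balance) `ρ(S) ≤ 1`. As costs are positive, an agent of `S` whose marginal
contribution is zero would need an infinite share, so that `S` is then not feasible. -/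
def Feasible (S : Finset (Fin n)) : Prop :=
  (∀ i ∈ S, 0 < marginal I.f i S) ∧ I.share S ≤ 1

/-- The principal's utility `g(S) = (1 - ρ(S)) f(S)` (for sets `S` with finite share). -/
noncomputable def utility (S : Finset (Fin n)) : ℝ := (1 - I.share S) * I.f S

/-- The optimal welfare over all feasible sets. This is the supremum of a finite set of reals,
which contains `0` because the empty set is feasible. -/
noncomputable def optWelfare : ℝ := sSup {w | ∃ S, I.Feasible S ∧ w = I.welfare S}

end Setting

/-! ### Algorithms: programs of a real RAM with a value oracle

A program works on index variables holding natural numbers, on arrays of real numbers, and on arrays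
of bits (which represent sets of agents). Each of these is named by a natural number; a program
mentions only finitely many names, but the arrays are indexed by the values of index expressions and
are as long as needed. Real arithmetic (field operations and comparisons with `≤`) is exact and has
unit cost; there is no rounding and there are no other functions of real numbers. Indices can only
be added and compared. -/

/-- Memory contents. -/
structure State where
  idx : ℕ → ℕ
  real : ℕ → ℕ → ℝ
  bit : ℕ → ℕ → Bool

/-- Index expressions. -/
inductive IdxExpr where
  | const (k : ℕ)
  | var (x : ℕ)
  | add (e₁ e₂ : IdxExpr)

/-- Real expressions; constants are rational, and `get a e` is the entry number `e` of array `a`. -/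
inductive RealExpr where
  | const (q : ℚ)
  | get (a : ℕ) (e : IdxExpr)
  | add (r₁ r₂ : RealExpr)
  | sub (r₁ r₂ : RealExpr)
  | mul (r₁ r₂ : RealExpr)
  | div (r₁ r₂ : RealExpr)

/-- Tests; `bit b e` reads the entry number `e` of the bit array `b`. -/
inductive Test where
  | idxLe (e₁ e₂ : IdxExpr)
  | realLe (r₁ r₂ : RealExpr)
  | bit (b : ℕ) (e : IdxExpr)
  | not (t : Test)
  | and (t₁ t₂ : Test)

/-- Programs. `query b a e` asks the value oracle for the value of the set stored in the bit
array `b` and writes the answer to entry `e` of the real array `a`. -/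
inductive Program where
  | skip
  | setIdx (x : ℕ) (e : IdxExpr)
  | setReal (a : ℕ) (e : IdxExpr) (r : RealExpr)
  | setBit (b : ℕ) (e : IdxExpr) (v : Bool)
  | query (b a : ℕ) (e : IdxExpr)
  | seq (P Q : Program)
  | cond (t : Test) (P Q : Program)
  | loop (t : Test) (P : Program)

/-- Value of an index expression. -/
def IdxExpr.eval (s : State) : IdxExpr → ℕ
  | const k => k
  | var x => s.idx x
  | add e₁ e₂ => e₁.eval s + e₂.eval s

/-- Value of a real expression. Division by zero yields `0`. -/
noncomputable def RealExpr.eval (s : State) : RealExpr → ℝ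
  | const q => (q : ℝ)
  | get a e => s.real a (e.eval s)
  | add r₁ r₂ => r₁.eval s + r₂.eval s
  | sub r₁ r₂ => r₁.eval s - r₂.eval s
  | mul r₁ r₂ => r₁.eval s * r₂.eval s
  | div r₁ r₂ => r₁.eval s / r₂.eval s

/-- Truth of a test. -/
def Test.Holds (s : State) : Test → Prop
  | idxLe e₁ e₂ => e₁.eval s ≤ e₂.eval s
  | realLe r₁ r₂ => r₁.eval s ≤ r₂.eval s
  | bit b e => s.bit b (e.eval s) = true
  | not t => ¬ t.Holds s
  | and t₁ t₂ => t₁.Holds s ∧ t₂.Holds s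

/-- Number of steps for evaluating an index expression: one for each node. -/
def IdxExpr.cost : IdxExpr → ℕ
  | const _ => 1
  | var _ => 1
  | add e₁ e₂ => e₁.cost + e₂.cost + 1

/-- Number of steps for evaluating a real expression: one for each node. -/
def RealExpr.cost : RealExpr → ℕ
  | const _ => 1
  | get _ e => e.cost + 1
  | add r₁ r₂ => r₁.cost + r₂.cost + 1
  | sub r₁ r₂ => r₁.cost + r₂.cost + 1
  | mul r₁ r₂ => r₁.cost + r₂.cost + 1
  | div r₁ r₂ => r₁.cost + r₂.cost + 1

/-- Number of steps for evaluating a test: one for each node. -/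
def Test.cost : Test → ℕ
  | idxLe e₁ e₂ => e₁.cost + e₂.cost + 1
  | realLe r₁ r₂ => r₁.cost + r₂.cost + 1
  | bit _ e => e.cost + 1
  | not t => t.cost + 1
  | and t₁ t₂ => t₁.cost + t₂.cost + 1

/-- The set of agents stored in the bit array `b`. -/
def State.agents (s : State) (n b : ℕ) : Finset (Fin n) :=
  Finset.univ.filter fun i => s.bit b i = true

/-- Assignment to an index variable. -/
def State.putIdx (s : State) (x k : ℕ) : State :=
  { s with idx := Function.update s.idx x k }

/-- Assignment to an entry of a real array. -/
noncomputable def State.putReal (s : State) (a k : ℕ) (v : ℝ) : State :=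
  { s with real := Function.update s.real a (Function.update (s.real a) k v) }

/-- Assignment to an entry of a bit array. -/
def State.putBit (s : State) (b k : ℕ) (v : Bool) : State :=
  { s with bit := Function.update s.bit b (Function.update (s.bit b) k v) }

/-- `Runs f P s t s'`: with value oracle `f`, the program `P` started in the memory `s` halts after
exactly `t` steps with the memory `s'`. An oracle call costs `n + 1` steps on top of the
evaluation of the target index, as the oracle is handed an `n`-bit description of a set. -/
inductive Runs {n : ℕ} (f : Finset (Fin n) → ℝ) : Program → State → ℕ → State → Prop where
  | skip (s : State) : Runs f .skip s 1 s
  | setIdx (x : ℕ) (e : IdxExpr) (s : State) :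
      Runs f (.setIdx x e) s (e.cost + 1) (s.putIdx x (e.eval s))
  | setReal (a : ℕ) (e : IdxExpr) (r : RealExpr) (s : State) :
      Runs f (.setReal a e r) s (e.cost + r.cost + 1) (s.putReal a (e.eval s) (r.eval s))
  | setBit (b : ℕ) (e : IdxExpr) (v : Bool) (s : State) :
      Runs f (.setBit b e v) s (e.cost + 1) (s.putBit b (e.eval s) v)
  | query (b a : ℕ) (e : IdxExpr) (s : State) :
      Runs f (.query b a e) s (e.cost + n + 1) (s.putReal a (e.eval s) (f (s.agents n b)))
  | seq {P Q : Program} {s s₁ s₂ : State} {t₁ t₂ : ℕ} :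
      Runs f P s t₁ s₁ → Runs f Q s₁ t₂ s₂ → Runs f (.seq P Q) s (t₁ + t₂ + 1) s₂
  | cond_true {b : Test} {P Q : Program} {s s' : State} {t : ℕ} :
      b.Holds s → Runs f P s t s' → Runs f (.cond b P Q) s (b.cost + t + 1) s'
  | cond_false {b : Test} {P Q : Program} {s s' : State} {t : ℕ} :
      ¬ b.Holds s → Runs f Q s t s' → Runs f (.cond b P Q) s (b.cost + t + 1) s'
  | loop_true {b : Test} {P : Program} {s s₁ s₂ : State} {t₁ t₂ : ℕ} :
      b.Holds s → Runs f P s t₁ s₁ → Runs f (.loop b P) s₁ t₂ s₂ →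
        Runs f (.loop b P) s (b.cost + t₁ + t₂ + 1) s₂
  | loop_false {b : Test} {P : Program} {s : State} :
      ¬ b.Holds s → Runs f (.loop b P) s (b.cost + 1) s

/-- Programs are deterministic: final memory and running time are determined by the input. -/
theorem Runs.deterministic {n : ℕ} {f : Finset (Fin n) → ℝ} {P : Program} {s s₁ s₂ : State}
    {t₁ t₂ : ℕ} (h₁ : Runs f P s t₁ s₁) (h₂ : Runs f P s t₂ s₂) : t₁ = t₂ ∧ s₁ = s₂ := by
  induction h₁ generalizing t₂ s₂ with
  | skip | setIdx | setReal | setBit | query => cases h₂; exact ⟨rfl, rfl⟩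
  | seq _ _ ih₁ ih₂ =>
    cases h₂ with
    | seq h h' =>
      obtain ⟨rfl, rfl⟩ := ih₁ h
      obtain ⟨rfl, rfl⟩ := ih₂ h'
      exact ⟨rfl, rfl⟩
  | cond_true hb _ ih =>
    cases h₂ with
    | cond_true _ h => obtain ⟨rfl, rfl⟩ := ih h; exact ⟨rfl, rfl⟩
    | cond_false hb' _ => exact absurd hb hb'
  | cond_false hb _ ih =>
    cases h₂ with
    | cond_true hb' _ => exact absurd hb' hb
    | cond_false _ h => obtain ⟨rfl, rfl⟩ := ih h; exact ⟨rfl, rfl⟩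
  | loop_true hb _ _ ih₁ ih₂ =>
    cases h₂ with
    | loop_true _ h h' =>
      obtain ⟨rfl, rfl⟩ := ih₁ h
      obtain ⟨rfl, rfl⟩ := ih₂ h'
      exact ⟨rfl, rfl⟩
    | loop_false hb' => exact absurd hb hb'
  | loop_false hb =>
    cases h₂ with
    | loop_true hb' _ _ => exact absurd hb' hb
    | loop_false _ => exact ⟨rfl, rfl⟩

/-- The initial memory: index variable `0` holds `n`, the first `n` entries of the real array `0`
hold the agents' costs, and everything else is zero. The value function is not part of it. -/
noncomputable def initState {n : ℕ} (c : Fin n → ℝ) : State where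
  idx x := if x = 0 then n else 0
  real a k := if h : a = 0 ∧ k < n then c ⟨k, h.2⟩ else 0
  bit _ _ := false

/-- With costs `c` as input and access to `f` only through value queries, the program `P` halts
within `T` steps and outputs the set `S`, which it leaves in the bit array `0`. -/
def Outputs (P : Program) {n : ℕ} (f : Finset (Fin n) → ℝ) (c : Fin n → ℝ) (T : ℕ)
    (S : Finset (Fin n)) : Prop :=
  ∃ t s, t ≤ T ∧ Runs f P (initState c) t s ∧ s.agents n 0 = S

end TeamContracts

namespace TeamContracts

/-! ### Submodular functions -/

section Submodular

variable {n : ℕ} {f : Finset (Fin n) → ℝ}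

/-! Fix a guess x for the value of a target set and give agent i the price √(c_i x). If R is
feasible and f(R) ≥ x, AM-GM bounds the total price of R by (ρ(R) x + ∑ f(i:R)) / 2 ≤ f(R).
Conversely, if every agent of S has a marginal above a quarter of its price, then ρ(S) is at most
4/x times the total price of S, so a small total price means a small share.

Call an agent cheap if its cost is at most half its value, let M be the largest value of a cheap
agent, and take x ≥ 32M. One pass over the cheap agents adds an agent whose marginal is at least
half its price, as long as the value is below x/32. If some feasible set of cheap agents has value
at least x, this pass reaches x/32 (`AddInv.value`); it overshoots by at most M, so the total price
is at most 2(x/32 + M) ≤ x/8. A second pass drops agents whose marginal is at most a quarter of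
their price. Dropping never decreases the value minus a quarter of the prices, so at least half of
the value survives. The result has ρ ≤ 1/2, hence utility at least half its value
(`DropInv.half_le_utility`), which is at least x/128. All tests compare squares, so no square root
is ever computed.

A feasible set has at most one agent that is not cheap, and it adds at most the best singleton
utility b to the welfare; moreover M ≤ 2b. A set of cheap agents has value at most nM, so the
guesses (32 + k)M with k < n suffice, at a loss of M (`optWelfare_le`). The output is the best
candidate found. What remains is a loop rule with a time bound, used to show that a concrete program
maintains these invariants. -/

theorem Submodular.marginal_anti (hf : Submodular f) (i : Fin n) {S T : Finset (Fin n)}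
    (h : S ⊆ T) : marginal f i T ≤ marginal f i S := by
  have key : ∀ U S : Finset (Fin n), i ∉ U → i ∉ S → marginal f i (S ∪ U) ≤ marginal f i S := by
    intro U
    induction U using Finset.induction_on with
    | empty => intro S _ _; simp
    | insert j U hj ih =>
      intro S hU hS
      rw [Finset.mem_insert, not_or] at hU
      by_cases hjS : j ∈ S
      · rw [Finset.union_insert, Finset.insert_eq_of_mem (Finset.mem_union_left _ hjS)]
        exact ih S hU.2 hS
      · have : S ∪ insert j U = insert j S ∪ U := by
          rw [Finset.union_insert, Finset.insert_union]
        rw [this]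
        refine (ih _ hU.2 ?_).trans (hf S i j hS hjS)
        simp [hU.1, hS]
  -- The marginal of i does not depend on whether i itself lies in the set, so both sets may be
  -- assumed to avoid i.
  have h1 : ∀ S : Finset (Fin n), marginal f i S = marginal f i (S.erase i) := by
    intro S
    rw [marginal, marginal, (Finset.ext fun j => by by_cases h : j = i <;> simp [h] :
      insert i (S.erase i) = insert i S), Finset.erase_idem]
  rw [h1 T, h1 S]
  have h2 : S.erase i ∪ T.erase i = T.erase i :=
    Finset.union_eq_right.2 (Finset.erase_subset_erase i h)
  rw [← h2]
  exact key _ _ (by simp) (by simp)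

theorem marginal_of_notMem {i : Fin n} {S : Finset (Fin n)} (h : i ∉ S) :
    marginal f i S = f (insert i S) - f S := by
  rw [marginal, Finset.erase_eq_of_notMem h]

theorem marginal_of_mem {i : Fin n} {S : Finset (Fin n)} (h : i ∈ S) :
    marginal f i S = f S - f (S.erase i) := by
  rw [marginal, Finset.insert_eq_of_mem h]

theorem Submodular.union_le (hf : Submodular f) (S R : Finset (Fin n)) :
    f (S ∪ R) ≤ f S + ∑ i ∈ R \ S, marginal f i S := by
  induction R using Finset.induction_on with
  | empty => simp
  | insert j R hj ih =>
    by_cases hS : j ∈ S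
    · rw [Finset.union_insert, Finset.insert_eq_of_mem (Finset.mem_union_left _ hS),
        Finset.insert_sdiff_of_mem _ hS]
      exact ih
    · rw [Finset.union_insert, Finset.insert_sdiff_of_notMem _ hS,
        Finset.sum_insert (by simp [hj])]
      have h1 := hf.marginal_anti j (Finset.subset_union_left : S ⊆ S ∪ R)
      rw [marginal_of_notMem (S := S ∪ R) (by simp [hj, hS])] at h1
      linarith

/-- Build R up one agent at a time: each agent contributes at least its marginal at the full set,
and the contributions telescope. -/
theorem Submodular.sum_marginal_le (hf : Submodular f) (h0 : f ∅ = 0) (R : Finset (Fin n)) :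
    ∑ i ∈ R, marginal f i R ≤ f R := by
  have key : ∀ T : Finset (Fin n), T ⊆ R → ∑ i ∈ T, marginal f i R ≤ f T := by
    intro T
    induction T using Finset.induction_on with
    | empty => simp [h0]
    | insert j T hj ih =>
      intro hT
      rw [Finset.sum_insert hj]
      have h1 := hf.marginal_anti j ((Finset.subset_insert j T).trans hT)
      rw [marginal_of_notMem hj] at h1
      have := ih ((Finset.subset_insert j T).trans hT)
      linarith
  exact key R subset_rfl

end Submodular

/-! ### Feasible sets, cheap agents and prices -/

namespace Setting

variable {n : ℕ} (I : Setting n)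

theorem f_nonneg (S : Finset (Fin n)) : 0 ≤ I.f S := by
  rw [← I.f_empty]; exact I.f_mono (Finset.empty_subset S)

theorem marginal_nonneg (i : Fin n) (S : Finset (Fin n)) : 0 ≤ marginal I.f i S :=
  sub_nonneg.2 (I.f_mono ((Finset.erase_subset i S).trans (Finset.subset_insert i S)))

variable {I}

theorem marginal_le_single (hf : Submodular I.f) (i : Fin n) (S : Finset (Fin n)) :
    marginal I.f i S ≤ I.f {i} := by
  have := hf.marginal_anti i (Finset.empty_subset S)
  rw [marginal_of_notMem (Finset.notMem_empty i)] at this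
  simpa [I.f_empty] using this

theorem f_le_sum_single (hf : Submodular I.f) (S R : Finset (Fin n)) :
    I.f (S ∪ R) ≤ I.f S + ∑ i ∈ R \ S, I.f {i} :=
  (hf.union_le S R).trans
    (add_le_add_right (Finset.sum_le_sum fun i _ => marginal_le_single hf i S) _)

theorem Feasible.subset (hf : Submodular I.f) {S R : Finset (Fin n)} (hS : I.Feasible S)
    (h : R ⊆ S) : I.Feasible R := by
  refine ⟨fun i hi => (hS.1 i (h hi)).trans_le (hf.marginal_anti i h), le_trans ?_ hS.2⟩
  calc I.share R ≤ ∑ i ∈ R, I.c i / marginal I.f i S :=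
        Finset.sum_le_sum fun i hi => div_le_div_of_nonneg_left (I.c_pos i).le (hS.1 i (h hi))
          (hf.marginal_anti i h)
    _ ≤ I.share S := Finset.sum_le_sum_of_subset_of_nonneg h fun i _ _ =>
        div_nonneg (I.c_pos i).le (I.marginal_nonneg i S)

theorem feasible_empty : I.Feasible ∅ := by simp [Feasible, share]

theorem utility_empty : I.utility ∅ = 0 := by simp [utility, I.f_empty]

theorem feasible_single (i : Fin n) : I.Feasible {i} := by
  have h : marginal I.f i {i} = I.f {i} := by simp [marginal, I.f_empty]
  refine ⟨?_, ?_⟩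
  · simpa [h] using I.f_single_pos i
  · simpa [share, h] using div_le_one_of_le₀ (I.c_le i) (I.f_single_pos i).le

theorem utility_single (i : Fin n) : I.utility {i} = I.f {i} - I.c i := by
  have h : marginal I.f i {i} = I.f {i} := by simp [marginal, I.f_empty]
  have := (I.f_single_pos i).ne'
  simp only [utility, share, Finset.sum_singleton, h]
  field_simp

variable (I)

/-- The agents whose cost is at most half of their value. -/
noncomputable def cheap : Finset (Fin n) := Finset.univ.filter fun i => 2 * I.c i ≤ I.f {i}

variable {I}

theorem mem_cheap {i : Fin n} : i ∈ I.cheap ↔ 2 * I.c i ≤ I.f {i} := by simp [cheap]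

/-- A feasible set contains at most one agent that is not cheap. -/
theorem Feasible.card_sdiff_cheap_le (hf : Submodular I.f) {S : Finset (Fin n)}
    (hS : I.Feasible S) : (S \ I.cheap).card ≤ 1 := by
  have half : ∀ i ∈ S \ I.cheap, 1 / 2 < I.c i / marginal I.f i S := by
    intro i hi
    rw [Finset.mem_sdiff, mem_cheap, not_le] at hi
    rw [lt_div_iff₀ (hS.1 i hi.1)]
    linarith [marginal_le_single hf i S]
  rw [Finset.card_le_one]
  intro a ha b hb
  by_contra hab
  have h1 : ∑ i ∈ {a, b}, I.c i / marginal I.f i S ≤ I.share S :=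
    Finset.sum_le_sum_of_subset_of_nonneg
      (by intro i hi
          rw [Finset.mem_insert, Finset.mem_singleton] at hi
          rcases hi with rfl | rfl
          exacts [(Finset.mem_sdiff.1 ha).1, (Finset.mem_sdiff.1 hb).1])
      fun i _ _ => div_nonneg (I.c_pos i).le (I.marginal_nonneg i S)
  rw [Finset.sum_pair hab] at h1
  linarith [half a ha, half b hb, hS.2]

/-- By subadditivity, the at most one agent outside `I.cheap` adds no more than its own value; net
of its cost this is at most b. The costs of the cheap agents are discarded. -/
theorem Feasible.welfare_le (hf : Submodular I.f) {S : Finset (Fin n)} (hS : I.Feasible S)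
    {b : ℝ} (hb : 0 ≤ b) (h : ∀ i, I.f {i} - I.c i ≤ b) :
    I.welfare S ≤ I.f (S ∩ I.cheap) + b := by
  have h1 := f_le_sum_single hf (S ∩ I.cheap) S
  rw [Finset.union_eq_right.2 Finset.inter_subset_left, Finset.sdiff_inter_self_left] at h1
  have h2 : ∑ i ∈ S \ I.cheap, I.c i ≤ ∑ i ∈ S, I.c i :=
    Finset.sum_le_sum_of_subset_of_nonneg Finset.sdiff_subset fun i _ _ => (I.c_pos i).le
  have h3 : ∑ i ∈ S \ I.cheap, (I.f {i} - I.c i) ≤ (S \ I.cheap).card • b :=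
    Finset.sum_le_card_nsmul _ _ _ fun i _ => h i
  have h4 : (S \ I.cheap).card • b ≤ b := by
    rw [nsmul_eq_mul]
    exact mul_le_of_le_one_left hb (by exact_mod_cast hS.card_sdiff_cheap_le hf)
  rw [Finset.sum_sub_distrib] at h3
  unfold welfare
  linarith

/-- The price sum of a feasible set of value at least `x` is at most its value. -/
theorem Feasible.sum_sqrt_le (hf : Submodular I.f) {R : Finset (Fin n)} (hR : I.Feasible R)
    {x : ℝ} (hx : 0 ≤ x) (hxR : x ≤ I.f R) : ∑ i ∈ R, √(I.c i * x) ≤ I.f R := by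
  -- AM-GM for the factorization c_i x = (c_i / f(i:R) · x) · f(i:R). Summed over R, the first
  -- factors give ρ(R) x ≤ x ≤ f(R), the second ones at most f(R).
  have amgm : ∀ i ∈ R, √(I.c i * x) ≤ (I.c i / marginal I.f i R * x + marginal I.f i R) / 2 := by
    intro i hi
    have hm := hR.1 i hi
    have hd := div_nonneg (I.c_pos i).le hm.le
    rw [Real.sqrt_le_left (by positivity)]
    have : I.c i * x = (I.c i / marginal I.f i R * x) * marginal I.f i R := by
      field_simp
    rw [this]
    nlinarith [sq_nonneg (I.c i / marginal I.f i R * x - marginal I.f i R)]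
  refine (Finset.sum_le_sum amgm).trans ?_
  rw [← Finset.sum_div, Finset.sum_add_distrib, ← Finset.sum_mul]
  have h1 := hf.sum_marginal_le I.f_empty R
  have h2 : (∑ i ∈ R, I.c i / marginal I.f i R) * x ≤ 1 * x :=
    mul_le_mul_of_nonneg_right hR.2 hx
  linarith

/-! ### The two passes of the algorithm -/

variable (I)

/-- Invariant of the pass that adds agents, after the agents below `k` were considered. -/
structure AddInv (M x : ℝ) (k : ℕ) (S : Finset (Fin n)) : Prop where
  lt : ∀ i ∈ S, (i : ℕ) < k
  cheap : S ⊆ I.cheap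
  price : ∑ i ∈ S, √(I.c i * x) ≤ 2 * I.f S
  le : I.f S ≤ x / 32 + M
  maximal : x / 32 ≤ I.f S ∨
    ∀ i : Fin n, (i : ℕ) < k → i ∈ I.cheap → i ∉ S → marginal I.f i S ≤ √(I.c i * x) / 2

/-- Invariant of the pass that drops agents of a set of value at least `F`, after the agents
below `k` were considered. -/
structure DropInv (M x F : ℝ) (k : ℕ) (S : Finset (Fin n)) : Prop where
  cheap : S ⊆ I.cheap
  price : ∑ i ∈ S, √(I.c i * x) ≤ 2 * (x / 32 + M)
  surplus : F / 2 ≤ I.f S - ∑ i ∈ S, √(I.c i * x) / 4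
  stable : ∀ i ∈ S, (i : ℕ) < k → √(I.c i * x) / 4 < marginal I.f i S

variable {I} {M x F : ℝ} {k : ℕ} {S : Finset (Fin n)}

theorem AddInv.zero (hM : 0 ≤ M) (hx : 0 ≤ x) : I.AddInv M x 0 ∅ where
  lt := by simp
  cheap := by simp
  price := by simp [I.f_empty]
  le := by rw [I.f_empty]; positivity
  maximal := Or.inr fun i hi => absurd hi (Nat.not_lt_zero _)

theorem AddInv.notMem (h : I.AddInv M x k S) {i : Fin n} (hi : (i : ℕ) = k) : i ∉ S :=
  fun hS => (h.lt i hS).ne hi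

/-- The condition `hs` is void for an agent that is not cheap and once the target x/32 is reached,
so this covers untested agents as well as rejected ones. -/
theorem AddInv.skip (h : I.AddInv M x k S) {i : Fin n} (hi : (i : ℕ) = k)
    (hs : i ∈ I.cheap → I.f S < x / 32 → 4 * (I.f (insert i S) - I.f S) ^ 2 < I.c i * x) :
    I.AddInv M x (k + 1) S where
  lt j hj := (h.lt j hj).trans (Nat.lt_succ_self k)
  cheap := h.cheap
  price := h.price
  le := h.le
  maximal := by
    rcases le_or_gt (x / 32) (I.f S) with hS | hS
    · exact Or.inl hS
    · refine Or.inr fun j hj hjc hjS => ?_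
      rcases Nat.lt_succ_iff_lt_or_eq.1 hj with hj | hj
      · exact (h.maximal.resolve_left hS.not_ge) j hj hjc hjS
      · obtain rfl : j = i := Fin.ext (hj.trans hi.symm)
        have := hs hjc hS
        rw [marginal_of_notMem hjS, le_div_iff₀ two_pos]
        apply Real.le_sqrt_of_sq_le
        linarith [mul_pow (I.f (insert j S) - I.f S) 2 2]

theorem AddInv.insert (hf : Submodular I.f) (h : I.AddInv M x k S) {i : Fin n} (hi : (i : ℕ) = k)
    (hM : ∀ j ∈ I.cheap, I.f {j} ≤ M) (hic : i ∈ I.cheap) (hS : I.f S < x / 32)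
    (hm : I.c i * x ≤ 4 * (I.f (insert i S) - I.f S) ^ 2) :
    I.AddInv M x (k + 1) (insert i S) where
  lt j hj := by
    rcases Finset.mem_insert.1 hj with rfl | hj
    · omega
    · exact (h.lt j hj).trans (Nat.lt_succ_self k)
  cheap := Finset.insert_subset hic h.cheap
  price := by
    have hnot := h.notMem hi
    have h0 := I.marginal_nonneg i S
    rw [marginal_of_notMem hnot] at h0
    have : √(I.c i * x) ≤ 2 * (I.f (Insert.insert i S) - I.f S) :=
      Real.sqrt_le_iff.2 ⟨by positivity, by linarith [mul_pow 2 (I.f (Insert.insert i S) - I.f S) 2]⟩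
    rw [Finset.sum_insert hnot]
    linarith [h.price]
  le := by
    have := marginal_le_single hf i S
    rw [marginal_of_notMem (h.notMem hi)] at this
    linarith [hM i hic]
  maximal := by
    rcases h.maximal with h' | h'
    · exact absurd h' hS.not_ge
    · refine Or.inr fun j hj hjc hjS => ?_
      rw [Finset.mem_insert, not_or] at hjS
      have hjk : (j : ℕ) < k := by
        rcases Nat.lt_succ_iff_lt_or_eq.1 hj with hj | hj
        · exact hj
        · exact absurd (Fin.ext (hj.trans hi.symm)) hjS.1
      -- Agents rejected earlier stay rejected: enlarging the set only lowers their marginals.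
      exact (hf.marginal_anti j (Finset.subset_insert i S)).trans (h' j hjk hjc hjS.2)

/-- If the target was missed, every agent of R outside S has a marginal of at most half its price,
so f(R) ≤ f(S) + f(R)/2 and thus f(S) ≥ x/2. -/
theorem AddInv.value (hf : Submodular I.f) (h : I.AddInv M x n S) (hx : 0 ≤ x)
    {R : Finset (Fin n)} (hR : I.Feasible R) (hRc : R ⊆ I.cheap) (hxR : x ≤ I.f R) :
    x / 32 ≤ I.f S := by
  rcases h.maximal with h' | h'
  · exact h'
  · have h1 := hf.union_le S R
    have h2 : I.f R ≤ I.f (S ∪ R) := I.f_mono Finset.subset_union_right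
    have h3 : ∑ i ∈ R \ S, marginal I.f i S ≤ ∑ i ∈ R \ S, √(I.c i * x) / 2 := by
      refine Finset.sum_le_sum fun i hi => ?_
      rw [Finset.mem_sdiff] at hi
      exact h' i i.2 (hRc hi.1) hi.2
    have h4 : ∑ i ∈ R \ S, √(I.c i * x) / 2 ≤ ∑ i ∈ R, √(I.c i * x) / 2 :=
      Finset.sum_le_sum_of_subset_of_nonneg Finset.sdiff_subset fun i _ _ => by positivity
    rw [← Finset.sum_div R] at h4
    linarith [hR.sum_sqrt_le hf hx hxR]

theorem AddInv.dropInv (h : I.AddInv M x n S) : I.DropInv M x (I.f S) 0 S where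
  cheap := h.cheap
  price := by linarith [h.price, h.le]
  surplus := by rw [← Finset.sum_div]; linarith [h.price]
  stable i _ hi := absurd hi (Nat.not_lt_zero _)

/-- The loss of value is at most a quarter of the price removed, so the surplus does not decrease.
For i outside S nothing changes, and the program relies on this case too. -/
theorem DropInv.erase (hf : Submodular I.f) (h : I.DropInv M x F k S) {i : Fin n}
    (hi : (i : ℕ) = k) (hm : 16 * (I.f S - I.f (S.erase i)) ^ 2 ≤ I.c i * x) :
    I.DropInv M x F (k + 1) (S.erase i) where
  cheap := (Finset.erase_subset i S).trans h.cheap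
  price := (Finset.sum_le_sum_of_subset_of_nonneg (Finset.erase_subset i S)
    fun i _ _ => Real.sqrt_nonneg _).trans h.price
  surplus := by
    by_cases hS : i ∈ S
    · have h1 := h.surplus
      rw [← Finset.add_sum_erase S _ hS] at h1
      have : (I.f S - I.f (S.erase i)) * 4 ≤ √(I.c i * x) :=
        Real.le_sqrt_of_sq_le (by linarith [mul_pow (I.f S - I.f (S.erase i)) 4 2])
      linarith
    · rw [Finset.erase_eq_of_notMem hS]; exact h.surplus
  stable j hj hjk := by
    rw [Finset.mem_erase] at hj
    have hjk' : (j : ℕ) < k := by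
      rcases Nat.lt_succ_iff_lt_or_eq.1 hjk with hjk | hjk
      · exact hjk
      · exact absurd (Fin.ext (hjk.trans hi.symm)) hj.1
    exact (h.stable j hj.2 hjk').trans_le (hf.marginal_anti j (Finset.erase_subset i S))

theorem DropInv.keep (h : I.DropInv M x F k S) (hx : 0 ≤ x) {i : Fin n} (hi : (i : ℕ) = k)
    (hm : I.c i * x < 16 * (I.f S - I.f (S.erase i)) ^ 2) : I.DropInv M x F (k + 1) S where
  cheap := h.cheap
  price := h.price
  surplus := h.surplus
  stable j hj hjk := by
    rcases Nat.lt_succ_iff_lt_or_eq.1 hjk with hjk | hjk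
    · exact h.stable j hj hjk
    · obtain rfl : j = i := Fin.ext (hjk.trans hi.symm)
      have h0 := I.marginal_nonneg j S
      rw [marginal_of_mem hj] at h0 ⊢
      rw [div_lt_iff₀ four_pos]
      rw [Real.sqrt_lt (mul_nonneg (I.c_pos j).le hx) (by positivity)]
      linarith [mul_pow (I.f S - I.f (S.erase j)) 4 2]

/-- Stability gives c_i / f(i:S) ≤ (4/x) √(c_i x), and the prices sum to at most 2(x/32 + M) ≤ x/8;
hence ρ(S) ≤ 1/2. -/
theorem DropInv.half_le_utility (h : I.DropInv M x F n S) (hM : ∀ j ∈ I.cheap, I.f {j} ≤ M)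
    (hx : 32 * M ≤ x) : I.Feasible S ∧ I.f S / 2 ≤ I.utility S := by
  -- Without cheap agents M and x may be 0; then S is empty. A member of S forces M > 0, hence x >
  -- 0.
  rcases S.eq_empty_or_nonempty with rfl | ⟨a, ha⟩
  · simp [feasible_empty, utility_empty, I.f_empty]
  have hMpos : 0 < M := (I.f_single_pos a).trans_le (hM a (h.cheap ha))
  have hx0 : 0 < x := by linarith
  have hstab : ∀ i ∈ S, √(I.c i * x) / 4 < marginal I.f i S := fun i hi => h.stable i hi i.2
  have hr : ∀ i, 0 < √(I.c i * x) := fun i => Real.sqrt_pos.2 (mul_pos (I.c_pos i) hx0)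
  have hpos : ∀ i ∈ S, 0 < marginal I.f i S := fun i hi =>
    (div_pos (hr i) four_pos).trans (hstab i hi)
  have hle : ∀ i ∈ S, I.c i / marginal I.f i S ≤ √(I.c i * x) * (4 / x) := by
    intro i hi
    rw [div_le_iff₀ (hpos i hi)]
    have h1 : √(I.c i * x) * √(I.c i * x) = I.c i * x :=
      Real.mul_self_sqrt (mul_pos (I.c_pos i) hx0).le
    have h2 : I.c i = √(I.c i * x) * (4 / x) * (√(I.c i * x) / 4) := by
      field_simp
      linarith
    calc I.c i = √(I.c i * x) * (4 / x) * (√(I.c i * x) / 4) := h2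
      _ ≤ _ := mul_le_mul_of_nonneg_left (hstab i hi).le (by have := hr i; positivity)
  have hshare : I.share S ≤ 1 / 2 := by
    calc I.share S ≤ ∑ i ∈ S, √(I.c i * x) * (4 / x) := Finset.sum_le_sum hle
      _ = (∑ i ∈ S, √(I.c i * x)) * (4 / x) := by rw [Finset.sum_mul]
      _ ≤ (x / 8) * (4 / x) := by
        refine mul_le_mul_of_nonneg_right ?_ (by positivity)
        linarith [h.price]
      _ = 1 / 2 := by field_simp; norm_num
  refine ⟨⟨hpos, by linarith⟩, ?_⟩
  unfold utility
  nlinarith [I.f_nonneg S]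

theorem DropInv.value (h : I.DropInv M x F k S) : F / 2 ≤ I.f S := by
  have : 0 ≤ ∑ i ∈ S, √(I.c i * x) / 4 := Finset.sum_nonneg fun i _ => by positivity
  linarith [h.surplus]

/-- The values `(32 + k) M` are close enough to the value of every feasible set of cheap agents. -/
theorem optWelfare_le (hf : Submodular I.f) {b : ℝ} (hM0 : 0 ≤ M)
    (hM : ∀ j ∈ I.cheap, I.f {j} ≤ M) (hMb : M ≤ 2 * b) (hb : ∀ i, I.f {i} - I.c i ≤ b)
    (h : ∀ k < n, ∀ R, I.Feasible R → R ⊆ I.cheap → (32 + k) * M ≤ I.f R →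
      (32 + k) * M ≤ 128 * b) : I.optWelfare ≤ 468 * b := by
  have hb0 : 0 ≤ b := by linarith
  refine csSup_le ⟨_, ∅, feasible_empty, rfl⟩ ?_
  rintro _ ⟨S, hS, rfl⟩
  have h1 := hS.welfare_le hf hb0 hb
  set R := S ∩ I.cheap with hR
  have hRc : R ⊆ I.cheap := Finset.inter_subset_right
  have hRf : I.Feasible R := hS.subset hf Finset.inter_subset_left
  -- The argument has slack: with the extra b this gives 133 b.
  suffices I.f R ≤ 132 * b by linarith
  rcases le_or_gt (I.f R) (32 * M) with h32 | h32
  · linarith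
  have hRn : I.f R ≤ n * M := by
    have h2 := f_le_sum_single hf ∅ R
    rw [Finset.empty_union, Finset.sdiff_empty, I.f_empty, zero_add] at h2
    refine h2.trans ((Finset.sum_le_card_nsmul _ _ M fun i hi => hM i (hRc hi)).trans ?_)
    rw [nsmul_eq_mul]
    refine mul_le_mul_of_nonneg_right ?_ hM0
    exact_mod_cast (Finset.card_le_univ R).trans (Fintype.card_fin n).le
  have hMpos : 0 < M := by
    rcases hM0.eq_or_lt with h0 | h0
    · rw [← h0] at hRn h32; linarith
    · exact h0
  -- Round f(R)/M down: the guess (32 + k)M falls short of f(R) by less than M, and f(R) ≤ nM keeps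
  -- k below n.
  obtain ⟨k, hk⟩ : ∃ k, ⌊I.f R / M⌋₊ = 32 + k :=
    Nat.exists_eq_add_of_le (Nat.le_floor (by rw [le_div_iff₀ hMpos]; exact_mod_cast h32.le))
  have hlo : ((32 + k : ℕ) : ℝ) * M ≤ I.f R := by
    rw [← hk, ← le_div_iff₀ hMpos]
    exact Nat.floor_le (div_nonneg (I.f_nonneg R) hM0)
  have hhi : I.f R < ((32 + k : ℕ) + 1) * M := by
    rw [← hk, ← div_lt_iff₀ hMpos]
    exact Nat.lt_floor_add_one _
  have hkn : k < n := by
    have : ((32 + k : ℕ) : ℝ) ≤ n := le_of_mul_le_mul_right (hlo.trans hRn) hMpos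
    have : 32 + k ≤ n := by exact_mod_cast this
    omega
  push_cast at hlo hhi
  have h3 := h k hkn R hRf hRc hlo
  have h4 : (0 : ℝ) ≤ k := Nat.cast_nonneg k
  nlinarith

end Setting

/-! ### Total correctness of programs with a time bound -/

section Calculus

variable {n : ℕ} {f : Finset (Fin n) → ℝ} {P Q : Program} {T T₁ T₂ : ℕ}
  {post post' : State → Prop} {s : State}

/-- Started in `s`, the program `P` halts within `T` steps in a memory that satisfies `post`. -/
def Halts (f : Finset (Fin n) → ℝ) (P : Program) (T : ℕ) (post : State → Prop) (s : State) :
    Prop :=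
  ∃ t s', t ≤ T ∧ Runs f P s t s' ∧ post s'

theorem Halts.mono (h : Halts f P T₁ post s) (hT : T₁ ≤ T₂) (hp : ∀ s', post s' → post' s') :
    Halts f P T₂ post' s := by
  obtain ⟨t, s', ht, hr, hs⟩ := h
  exact ⟨t, s', ht.trans hT, hr, hp s' hs⟩

theorem halts_seq (h : Halts f P T₁ (Halts f Q T₂ post) s) :
    Halts f (.seq P Q) (T₁ + T₂ + 1) post s := by
  obtain ⟨t₁, s₁, ht₁, hr₁, t₂, s₂, ht₂, hr₂, hs⟩ := h
  exact ⟨_, s₂, by omega, .seq hr₁ hr₂, hs⟩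

/-- The weakest precondition of a program without loops. -/
def Program.wp (f : Finset (Fin n) → ℝ) : Program → (State → Prop) → State → Prop
  | .skip, post, s => post s
  | .setIdx x e, post, s => post (s.putIdx x (e.eval s))
  | .setReal a e r, post, s => post (s.putReal a (e.eval s) (r.eval s))
  | .setBit b e v, post, s => post (s.putBit b (e.eval s) v)
  | .query b a e, post, s => post (s.putReal a (e.eval s) (f (s.agents n b)))
  | .seq P Q, post, s => P.wp f (Q.wp f post) s
  | .cond b P Q, post, s => (b.Holds s → P.wp f post s) ∧ (¬ b.Holds s → Q.wp f post s)
  | .loop _ _, _, _ => False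

/-- A bound for the number of steps of a program without loops. -/
def Program.bound (n : ℕ) : Program → ℕ
  | .skip => 1
  | .setIdx _ e => e.cost + 1
  | .setReal _ e r => e.cost + r.cost + 1
  | .setBit _ e _ => e.cost + 1
  | .query _ _ e => e.cost + n + 1
  | .seq P Q => P.bound n + Q.bound n + 1
  | .cond b P Q => b.cost + max (P.bound n) (Q.bound n) + 1
  -- A dummy value: the precondition of a loop is `False`.
  | .loop _ _ => 0

theorem Program.wp.halts (h : P.wp f post s) (hT : P.bound n ≤ T) : Halts f P T post s := by
  suffices Halts f P (P.bound n) post s from this.mono hT fun _ h => h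
  clear hT
  induction P generalizing s post with
  | skip => exact ⟨1, s, le_rfl, .skip s, h⟩
  | setIdx x e => exact ⟨_, _, le_rfl, .setIdx x e s, h⟩
  | setReal a e r => exact ⟨_, _, le_rfl, .setReal a e r s, h⟩
  | setBit b e v => exact ⟨_, _, le_rfl, .setBit b e v s, h⟩
  | query b a e => exact ⟨_, _, le_rfl, .query b a e s, h⟩
  | seq P Q ihP ihQ => exact halts_seq ((ihP h).mono le_rfl fun _ h' => ihQ h')
  | cond b P Q ihP ihQ =>
    by_cases hb : b.Holds s
    · obtain ⟨t, s', ht, hr, hs⟩ := ihP (h.1 hb)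
      exact ⟨_, s', by simp only [Program.bound]; omega, .cond_true hb hr, hs⟩
    · obtain ⟨t, s', ht, hr, hs⟩ := ihQ (h.2 hb)
      exact ⟨_, s', by simp only [Program.bound]; omega, .cond_false hb hr, hs⟩
  | loop => exact h.elim

/-- Run `P` with index variable `x` set to `0, 1, …, n - 1`, where `n` is in index variable `0`. -/
def forAgents (x : ℕ) (P : Program) : Program :=
  .seq (.setIdx x (.const 0)) (.loop (.not (.idxLe (.var 0) (.var x)))
    (.seq P (.setIdx x (.add (.var x) (.const 1)))))

/-- The invariant speaks of the memory after the counter has been set, so a step must leave the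
counter at k and establish the invariant once k + 1 is written. Each round costs 10 steps besides
the body: 4 for the test, 4 for the increment, 2 for control. -/
theorem halts_forAgents {x : ℕ} (inv : ℕ → State → Prop)
    (hx : ∀ k s, inv k s → s.idx 0 = n ∧ s.idx x = k) (h0 : inv 0 (s.putIdx x 0))
    (hstep : ∀ k < n, ∀ s, inv k s →
      Halts f P T (fun s' => s'.idx x = k ∧ inv (k + 1) (s'.putIdx x (k + 1))) s)
    (hpost : ∀ s', inv n s' → post s') :
    Halts f (forAgents x P) (n * (T + 10) + 8) post s := by
  have key : ∀ d k s, k + d = n → inv k s →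
      Halts f (.loop (.not (.idxLe (.var 0) (.var x)))
        (.seq P (.setIdx x (.add (.var x) (.const 1))))) (d * (T + 10) + 5) post s := by
    intro d
    induction d with
    | zero =>
      intro k s hk hs
      obtain ⟨h1, h2⟩ := hx k s hs
      obtain rfl : k = n := by omega
      refine ⟨_, s, ?_, .loop_false ?_, hpost s hs⟩
      · simp [Test.cost, IdxExpr.cost]
      · simp [Test.Holds, IdxExpr.eval, h1, h2]
    | succ d ih =>
      intro k s hk hs
      obtain ⟨h1, h2⟩ := hx k s hs
      obtain ⟨t, s', ht, hr, hs'x, hs'⟩ := hstep k (by omega) s hs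
      obtain ⟨t', s'', ht', hr', hs''⟩ := ih (k + 1) _ (by omega) hs'
      have hset := Runs.setIdx (f := f) x (.add (.var x) (.const 1)) s'
      simp only [IdxExpr.eval, hs'x] at hset
      refine ⟨_, s'', ?_, .loop_true ?_ (.seq hr hset) hr', hs''⟩
      · simp only [Test.cost, IdxExpr.cost]
        rw [Nat.succ_mul]
        omega
      · simp only [Test.Holds, IdxExpr.eval, h1, h2]
        omega
  exact halts_seq ⟨2, _, le_rfl, .setIdx x (.const 0) s, key n 0 _ (by omega) h0⟩ |>.mono
    (by omega) fun _ h => h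

end Calculus

/-! ### Effect of assignments on memory, and frame conditions -/

section Memory

variable {n : ℕ} (s : State)

@[simp] theorem putIdx_idx (x k y : ℕ) :
    (s.putIdx x k).idx y = if y = x then k else s.idx y := by
  simp [State.putIdx, Function.update_apply]

@[simp] theorem putIdx_real (x k : ℕ) : (s.putIdx x k).real = s.real := rfl

@[simp] theorem putIdx_agents (x k b : ℕ) : (s.putIdx x k).agents n b = s.agents n b := rfl

@[simp] theorem putReal_idx (a k : ℕ) (v : ℝ) : (s.putReal a k v).idx = s.idx := rfl

@[simp] theorem putReal_agents (a k b : ℕ) (v : ℝ) :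
    (s.putReal a k v).agents n b = s.agents n b := rfl

@[simp] theorem putReal_real (a k a' k' : ℕ) (v : ℝ) :
    (s.putReal a k v).real a' k' = if a' = a ∧ k' = k then v else s.real a' k' := by
  by_cases h : a' = a
  · subst h; simp [State.putReal, Function.update_apply]
  · simp [State.putReal, h]

@[simp] theorem putBit_idx (b k : ℕ) (v : Bool) : (s.putBit b k v).idx = s.idx := rfl

@[simp] theorem putBit_real (b k : ℕ) (v : Bool) : (s.putBit b k v).real = s.real := rfl

theorem putBit_agents_of_ne {b b' : ℕ} (h : b' ≠ b) (k : ℕ) (v : Bool) :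
    (s.putBit b k v).agents n b' = s.agents n b' := by
  simp [State.agents, State.putBit, h]

theorem putBit_agents_true (b : ℕ) (i : Fin n) :
    (s.putBit b i true).agents n b = insert i (s.agents n b) := by
  ext j
  by_cases h : j = i <;> simp [State.agents, State.putBit, Function.update_apply, Fin.val_inj, h]

theorem putBit_agents_false (b : ℕ) (i : Fin n) :
    (s.putBit b i false).agents n b = (s.agents n b).erase i := by
  ext j
  by_cases h : j = i <;> simp [State.agents, State.putBit, Function.update_apply, Fin.val_inj, h]

/-- The memories agree outside the index variables `X`, the real arrays `R` and the bit arrays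
`B`. -/
structure Frame (n : ℕ) (X R B : Set ℕ) (s s' : State) : Prop where
  idx : ∀ x ∉ X, s'.idx x = s.idx x
  real : ∀ a ∉ R, s'.real a = s.real a
  agents : ∀ b ∉ B, s'.agents n b = s.agents n b

namespace Frame

variable {s} {s' : State} {X R B : Set ℕ}

theorem refl : Frame n X R B s s := ⟨fun _ _ => rfl, fun _ _ => rfl, fun _ _ => rfl⟩

theorem trans {s'' : State} {X' R' B' : Set ℕ} (h : Frame n X R B s s')
    (h' : Frame n X' R' B' s' s'') (hX : X' ⊆ X) (hR : R' ⊆ R) (hB : B' ⊆ B) :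
    Frame n X R B s s'' where
  idx x hx := (h'.idx x fun hx' => hx (hX hx')).trans (h.idx x hx)
  real a ha := (h'.real a fun ha' => ha (hR ha')).trans (h.real a ha)
  agents b hb := (h'.agents b fun hb' => hb (hB hb')).trans (h.agents b hb)

theorem putIdx (h : Frame n X R B s s') {x : ℕ} (hx : x ∈ X) (k : ℕ) :
    Frame n X R B s (s'.putIdx x k) where
  idx y hy := by
    rw [putIdx_idx, if_neg (by rintro rfl; exact hy hx), h.idx y hy]
  real := h.real
  agents := h.agents

theorem putReal (h : Frame n X R B s s') {a : ℕ} (ha : a ∈ R) (k : ℕ) (v : ℝ) :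
    Frame n X R B s (s'.putReal a k v) where
  idx := h.idx
  real a' ha' :=
    (Function.update_of_ne (by rintro rfl; exact ha' ha) _ _).trans (h.real a' ha')
  agents := h.agents

theorem putBit (h : Frame n X R B s s') {b : ℕ} (hb : b ∈ B) (k : ℕ) (v : Bool) :
    Frame n X R B s (s'.putBit b k v) where
  idx := h.idx
  real := h.real
  agents b' hb' := by
    rw [putBit_agents_of_ne _ (by rintro rfl; exact hb' hb), h.agents b' hb']

end Frame

theorem bit_iff_mem_agents (b : ℕ) (i : Fin n) : s.bit b i = true ↔ i ∈ s.agents n b := by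
  simp [State.agents]

end Memory

/-! ### The algorithm

Index variable `0` holds `n`; index variables `1`, `2`, `3` are loop counters. The bit arrays `0`,
`1`, `2` hold the output, the working set, and the cheap agents. The real array `0` holds the costs;
entry `0` of the real arrays `1`, …, `5` holds a lower bound for the utility of the output, the
largest value of a cheap agent, the guessed value `x`, the value of the working set, and
intermediate results. -/

/-- Make the working set the output if the number in the real array `5` is larger than that for
the output. -/
def keepBest : Program :=
  .cond (.realLe (.get 5 (.const 0)) (.get 1 (.const 0))) .skip
    (.seq (.setReal 1 (.const 0) (.get 5 (.const 0)))
      (forAgents 3 (.cond (.bit 1 (.var 3)) (.setBit 0 (.var 3) true) (.setBit 0 (.var 3) false))))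

/-- Make an agent the working set and compute its value and utility. -/
def startSingle : Program :=
  .seq (.setBit 1 (.var 2) true) <|
  .seq (.query 1 4 (.const 0)) <|
  .setReal 5 (.const 0) (.sub (.get 4 (.const 0)) (.get 0 (.var 2)))

/-- Empty the working set and update the set of cheap agents and the largest value of one. -/
def finishSingle : Program :=
  .seq (.setBit 1 (.var 2) false) <|
  .cond (.realLe (.mul (.const 2) (.get 0 (.var 2))) (.get 4 (.const 0)))
    (.seq (.setBit 2 (.var 2) true)
      (.cond (.realLe (.get 4 (.const 0)) (.get 2 (.const 0))) .skip
        (.setReal 2 (.const 0) (.get 4 (.const 0)))))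
    .skip

/-- Add an agent to the working set if its marginal contribution is large. -/
def addStep : Program :=
  .cond (.and (.bit 2 (.var 1))
      (.not (.realLe (.div (.get 3 (.const 0)) (.const 32)) (.get 4 (.const 0)))))
    (.seq (.setBit 1 (.var 1) true) <|
     .seq (.query 1 5 (.const 0)) <|
     .cond (.realLe (.mul (.get 0 (.var 1)) (.get 3 (.const 0)))
        (.mul (.const 4) (.mul (.sub (.get 5 (.const 0)) (.get 4 (.const 0)))
          (.sub (.get 5 (.const 0)) (.get 4 (.const 0))))))
      (.setReal 4 (.const 0) (.get 5 (.const 0)))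
      (.setBit 1 (.var 1) false))
    .skip

/-- Drop an agent from the working set if its marginal contribution is small. -/
def dropStep : Program :=
  .seq (.setBit 1 (.var 1) false) <|
  .seq (.query 1 5 (.const 0)) <|
  .cond (.realLe (.mul (.const 16) (.mul (.sub (.get 4 (.const 0)) (.get 5 (.const 0)))
          (.sub (.get 4 (.const 0)) (.get 5 (.const 0)))))
        (.mul (.get 0 (.var 1)) (.get 3 (.const 0))))
    (.setReal 4 (.const 0) (.get 5 (.const 0)))
    (.setBit 1 (.var 1) true)

/-- Compute a working set for the guessed value. -/
def passes : Program :=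
  .seq (forAgents 1 (.setBit 1 (.var 1) false)) <|
  .seq (.setReal 4 (.const 0) (.const 0)) <|
  .seq (forAgents 1 addStep) (forAgents 1 dropStep)

/-- Try a guessed value and move on to the next one. -/
def guessStep : Program :=
  .seq passes <|
  .seq (.setReal 5 (.const 0) (.div (.get 4 (.const 0)) (.const 2))) <|
  .seq keepBest <|
  .setReal 3 (.const 0) (.add (.get 3 (.const 0)) (.get 2 (.const 0)))

/-- The algorithm. -/
def approxProgram : Program :=
  .seq (forAgents 2 (.seq startSingle (.seq keepBest finishSingle))) <|
  .seq (.setReal 3 (.const 0) (.mul (.const 32) (.get 2 (.const 0))))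
    (forAgents 2 guessStep)

/-! ### Correctness and running time of the algorithm -/

section Correctness

variable {n : ℕ} {I : Setting n} {s s₀ : State}

/-- The memory holds the input, and a feasible output of at least the utility stored. -/
structure Sound (I : Setting n) (s : State) : Prop where
  idx : s.idx 0 = n
  cost : ∀ i : Fin n, s.real 0 i = I.c i
  feasible : I.Feasible (s.agents n 0)
  best : s.real 1 0 ≤ I.utility (s.agents n 0)

theorem Sound.of_frame {s' : State} {X R B : Set ℕ} (h : Sound I s) (hs : Frame n X R B s s')
    (hX : 0 ∉ X) (hR0 : 0 ∉ R) (hR1 : 1 ∉ R) (hB : 0 ∉ B) : Sound I s' where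
  idx := by rw [hs.idx 0 hX, h.idx]
  cost i := by rw [hs.real 0 hR0, h.cost]
  feasible := by rw [hs.agents 0 hB]; exact h.feasible
  best := by rw [hs.real 1 hR1, hs.agents 0 hB]; exact h.best

/-- The candidate's score only has to be a lower bound for its utility; this allows half the value
to serve as the score of a guess. -/
theorem halts_keepBest {f : Finset (Fin n) → ℝ} (hs : Sound I s)
    (hS : I.Feasible (s.agents n 1)) (hu : s.real 5 0 ≤ I.utility (s.agents n 1)) :
    Halts f keepBest (n * 20 + 30)
      (fun s' => Sound I s' ∧ Frame n {3} {1} {0} s s' ∧ s.real 1 0 ≤ s'.real 1 0 ∧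
        s.real 5 0 ≤ s'.real 1 0) s := by
  have hcopy : Halts f (.seq (.setReal 1 (.const 0) (.get 5 (.const 0)))
      (forAgents 3 (.cond (.bit 1 (.var 3)) (.setBit 0 (.var 3) true)
        (.setBit 0 (.var 3) false)))) (n * 20 + 20)
      (fun s' => Frame n {3} {1} {0} s s' ∧ s'.agents n 0 = s.agents n 1 ∧
        s'.real 1 0 = s.real 5 0) s := by
    refine (halts_seq (T₁ := 5) (T₂ := n * (10 + 10) + 8)
      (Program.wp.halts (?_ : Program.wp f _ _ _) ?_)).mono (by omega) fun _ h => h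
    · refine halts_forAgents (fun k s' => Frame n {3} {1} {0} s s' ∧ s'.idx 3 = k ∧
        s'.real 1 0 = s.real 5 0 ∧
        ∀ i : Fin n, (i : ℕ) < k → (i ∈ s'.agents n 0 ↔ i ∈ s.agents n 1)) ?_ ?_ ?_ ?_
      · rintro k s' ⟨h, hk, -⟩
        exact ⟨by rw [h.idx 0 (by simp), hs.idx], hk⟩
      · exact ⟨(Frame.refl.putReal (by simp) _ _).putIdx (by simp) _, by simp,
          by simp [RealExpr.eval, IdxExpr.eval], by simp⟩
      · rintro k hk s' ⟨h, hk3, hb, hag⟩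
        have h1 := h.agents 1 (by simp)
        obtain ⟨i, rfl⟩ : ∃ i : Fin n, (i : ℕ) = k := ⟨⟨k, hk⟩, rfl⟩
        refine Program.wp.halts ?_
          (by simp [Program.bound, Test.cost, IdxExpr.cost])
        simp only [Program.wp, Test.Holds, IdxExpr.eval, hk3, bit_iff_mem_agents, h1]
        refine ⟨fun hi => ⟨by simpa using hk3, (h.putBit (by simp) _ _).putIdx (by simp) _, by simp,
          by simpa using hb, fun j hj => ?_⟩, fun hi => ⟨by simpa using hk3,
          (h.putBit (by simp) _ _).putIdx (by simp) _, by simp, by simpa using hb, fun j hj => ?_⟩⟩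
        all_goals
          simp only [putIdx_agents, putBit_agents_true, putBit_agents_false, Finset.mem_insert,
            Finset.mem_erase]
          by_cases hji : j = i
          · subst hji; simp [hi]
          · have := hag j (lt_of_le_of_ne (Nat.lt_succ_iff.1 hj) fun h' => hji (Fin.ext h'))
            simp [hji, this]
      · rintro s' ⟨h, -, hb, hag⟩
        exact ⟨h, Finset.ext fun i => hag i i.2, hb⟩
    · simp [Program.bound, RealExpr.cost, IdxExpr.cost]
  by_cases hle : s.real 5 0 ≤ s.real 1 0
  · exact ⟨_, s, by simp [Test.cost, RealExpr.cost, IdxExpr.cost], .cond_true hle (.skip s), hs,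
      Frame.refl, le_rfl, hle⟩
  · obtain ⟨t, s', ht, hr, hF, hag, hb⟩ := hcopy
    refine ⟨_, s', ?_, .cond_false hle hr, ⟨?_, ?_, ?_, ?_⟩, hF, ?_, hb.ge⟩
    · simp [Test.cost, RealExpr.cost, IdxExpr.cost]; omega
    · rw [hF.idx 0 (by simp), hs.idx]
    · intro i; rw [hF.real 0 (by simp), hs.cost]
    · rwa [hag]
    · rwa [hag, hb]
    · rw [hb]; exact (not_le.1 hle).le

/-- The set S in the conclusion is the working set between the two passes; its value is the
reference for the surplus in the second one. -/
theorem halts_passes (hf : Submodular I.f) {M x : ℝ} (hs : Sound I s)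
    (hA : s.agents n 2 = I.cheap) (hM : ∀ j ∈ I.cheap, I.f {j} ≤ M) (hM0 : 0 ≤ M)
    (hx : 0 ≤ x) (hsx : s.real 3 0 = x) :
    Halts I.f passes (n * 15 + 2 * (n * (n + 60)) + 40)
      (fun s' => Frame n {1} {4, 5} {1} s s' ∧ s'.real 4 0 = I.f (s'.agents n 1) ∧
        ∃ S, I.AddInv M x n S ∧ I.DropInv M x (I.f S) n (s'.agents n 1)) s := by
  have frame0 : ∀ {s'}, Frame n {1} {4, 5} {1} s s' → s'.idx 0 = n := fun h => by
    rw [h.idx 0 (by simp), hs.idx]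
  have frameC : ∀ {s'}, Frame n {1} {4, 5} {1} s s' → ∀ i : Fin n, s'.real 0 i = I.c i :=
    fun h i => by rw [h.real 0 (by simp), hs.cost]
  have frameX : ∀ {s'}, Frame n {1} {4, 5} {1} s s' → s'.real 3 0 = x := fun h => by
    rw [h.real 3 (by simp), hsx]
  have frameA : ∀ {s'}, Frame n {1} {4, 5} {1} s s' → s'.agents n 2 = I.cheap := fun h => by
    rw [h.agents 2 (by simp), hA]
  refine (halts_seq (T₁ := n * 13 + 8) (T₂ := 4 + ((n * (n + 60) + 8) + (n * (n + 60) + 8) + 1) + 1)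
    (halts_forAgents (T := 3) (fun k s' => Frame n {1} {4, 5} {1} s s' ∧ s'.idx 1 = k ∧
      ∀ i ∈ s'.agents n 1, k ≤ (i : ℕ)) ?_ ?_ ?_ ?_)).mono (by omega) fun _ h => h
  · rintro k s' ⟨h, hk, -⟩
    exact ⟨frame0 h, hk⟩
  · exact ⟨Frame.refl.putIdx (by simp) _, by simp, by simp⟩
  · rintro k hk s' ⟨h, hk1, hag⟩
    obtain ⟨i, rfl⟩ : ∃ i : Fin n, (i : ℕ) = k := ⟨⟨k, hk⟩, rfl⟩
    refine Program.wp.halts ?_ (by simp [Program.bound, IdxExpr.cost])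
    simp only [Program.wp, IdxExpr.eval, hk1]
    refine ⟨by simpa using hk1, (h.putBit (by simp) _ _).putIdx (by simp) _, by simp, fun j hj => ?_⟩
    rw [putIdx_agents, putBit_agents_false, Finset.mem_erase] at hj
    have := hag j hj.2
    have : (j : ℕ) ≠ i := fun h' => hj.1 (Fin.ext h')
    omega
  rintro s₁ ⟨h₁, -, hag₁⟩
  have hempty : s₁.agents n 1 = ∅ :=
    Finset.eq_empty_of_forall_notMem fun i hi => (hag₁ i hi).not_gt i.2
  refine halts_seq (Program.wp.halts ?_ (by simp [Program.bound, RealExpr.cost, IdxExpr.cost]))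
  simp only [Program.wp, RealExpr.eval, IdxExpr.eval]
  refine halts_seq ((halts_forAgents (T := n + 50) (fun k s' => Frame n {1} {4, 5} {1} s s' ∧
    s'.idx 1 = k ∧ s'.real 4 0 = I.f (s'.agents n 1) ∧ I.AddInv M x k (s'.agents n 1))
    ?_ ?_ ?_ ?_))
  · rintro k s' ⟨h, hk, -⟩
    exact ⟨frame0 h, hk⟩
  · exact ⟨(h₁.putReal (by simp) _ _).putIdx (by simp) _, by simp, by simp [hempty, I.f_empty],
      by simpa [hempty] using Setting.AddInv.zero hM0 hx⟩
  · rintro k hk s' ⟨h, hk1, hv, hinv⟩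
    obtain ⟨i, hi⟩ : ∃ i : Fin n, (i : ℕ) = k := ⟨⟨k, hk⟩, rfl⟩
    refine Program.wp.halts ?_
      (by simp [addStep, Program.bound, RealExpr.cost, IdxExpr.cost, Test.cost]; omega)
    have hnot := hinv.notMem hi
    subst hi
    have hF := h.putBit (b := 1) (by simp) i true
    have hF' := hF.putReal (a := 5) (by simp) 0 (I.f ((s'.putBit 1 i true).agents n 1))
    simp only [addStep, Program.wp, Test.Holds, RealExpr.eval, IdxExpr.eval, hk1,
      bit_iff_mem_agents, frameA h, frameX h, hv, putBit_agents_true, putReal_real, putBit_real,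
      putReal_idx, putBit_idx, frameC h, not_le] at hF' ⊢
    norm_num only [true_and, false_and, if_true, if_false]
    refine ⟨fun hc => ⟨fun hm => ⟨?_, ?_, ?_, ?_⟩, fun hm => ⟨?_, ?_, ?_, ?_⟩⟩,
      fun hc => ⟨?_, ?_, ?_, ?_⟩⟩
    · exact (hF'.putReal (by simp) _ _).putIdx (by simp) _
    · simp
    · simp [putBit_agents_true]
    · simp only [putIdx_agents, putReal_agents, putBit_agents_true]
      exact hinv.insert hf rfl hM hc.1 hc.2 (by linarith)
    · exact (hF'.putBit (by simp) _ _).putIdx (by simp) _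
    · simp
    · simp [putBit_agents_true, putBit_agents_false, hnot, hv]
    · simp only [putIdx_agents, putBit_agents_true, putBit_agents_false, putReal_agents,
        Finset.erase_insert hnot]
      exact hinv.skip rfl fun _ _ => by linarith
    · exact h.putIdx (by simp) _
    · simp
    · simpa using hv
    · exact hinv.skip rfl fun h1 h2 => absurd ⟨h1, h2⟩ hc
  rintro s₂ ⟨h₂, -, hv₂, hinv₂⟩
  refine halts_forAgents (T := n + 50) (fun k s' => Frame n {1} {4, 5} {1} s s' ∧
    s'.idx 1 = k ∧ s'.real 4 0 = I.f (s'.agents n 1) ∧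
    I.DropInv M x (I.f (s₂.agents n 1)) k (s'.agents n 1)) ?_ ?_ ?_
    fun s' h => ⟨h.1, h.2.2.1, _, hinv₂, h.2.2.2⟩
  · rintro k s' ⟨h, hk, -⟩
    exact ⟨frame0 h, hk⟩
  · exact ⟨h₂.putIdx (by simp) _, by simp, by simpa using hv₂, hinv₂.dropInv⟩
  · rintro k hk s' ⟨h, hk1, hv, hinv⟩
    obtain ⟨i, rfl⟩ : ∃ i : Fin n, (i : ℕ) = k := ⟨⟨k, hk⟩, rfl⟩
    refine Program.wp.halts ?_
      (by simp [dropStep, Program.bound, RealExpr.cost, IdxExpr.cost, Test.cost]; omega)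
    have hF := h.putBit (b := 1) (by simp) i false
    have hF' := hF.putReal (a := 5) (by simp) 0 (I.f ((s'.putBit 1 i false).agents n 1))
    simp only [dropStep, Program.wp, Test.Holds, RealExpr.eval, IdxExpr.eval, hk1,
      frameX h, hv, putBit_agents_false, putReal_real, putBit_real,
      putReal_idx, putBit_idx, frameC h, not_le] at hF' ⊢
    norm_num only [true_and, false_and, if_true, if_false]
    refine ⟨fun hm => ⟨?_, ?_, ?_, ?_⟩, fun hm => ⟨?_, ?_, ?_, ?_⟩⟩
    · exact (hF'.putReal (by simp) _ _).putIdx (by simp) _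
    · simp
    · simp [putBit_agents_false]
    · simp only [putIdx_agents, putReal_agents, putBit_agents_false]
      exact hinv.erase hf rfl (by linarith)
    all_goals
      -- An agent outside the working set has loss 0 and passes the drop test, so the branch that
      -- restores the bit is reached only by members.
      have hmem : i ∈ s'.agents n 1 := by
        by_contra hi
        rw [Finset.erase_eq_of_notMem hi] at hm
        have := mul_nonneg (I.c_pos i).le hx
        linarith
    · exact (hF'.putBit (by simp) _ _).putIdx (by simp) _
    · simp
    · simp [putBit_agents_true, putBit_agents_false, hmem, hv]
    · simp only [putIdx_agents, putBit_agents_true, putBit_agents_false, putReal_agents,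
        Finset.insert_erase hmem]
      exact hinv.keep hx rfl (by linarith)

/-- Invariant of the loop over the single agents. -/
structure SingleInv (I : Setting n) (k : ℕ) (s : State) : Prop where
  sound : Sound I s
  counter : s.idx 2 = k
  work : s.agents n 1 = ∅
  cheap : ∀ i : Fin n, i ∈ s.agents n 2 ↔ (i : ℕ) < k ∧ i ∈ I.cheap
  le_max : ∀ i ∈ s.agents n 2, I.f {i} ≤ s.real 2 0
  max_nonneg : 0 ≤ s.real 2 0
  max_le : s.real 2 0 ≤ 2 * s.real 1 0
  single_le : ∀ i : Fin n, (i : ℕ) < k → I.f {i} - I.c i ≤ s.real 1 0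

theorem SingleInv.step {i : Fin n} (h : SingleInv I i s) :
    Halts I.f (.seq startSingle (.seq keepBest finishSingle)) (n * 21 + 80)
      (fun s' => s'.idx 2 = i ∧ SingleInv I (i + 1) (s'.putIdx 2 (i + 1))) s := by
  refine (halts_seq (T₁ := n + 13) (T₂ := (n * 20 + 30) + 30 + 1)
    (Program.wp.halts ?_ ?_)).mono (by omega) fun _ h => h
  swap
  · simp only [startSingle, Program.bound, RealExpr.cost, IdxExpr.cost]
    omega
  have hF : Frame n ∅ {4, 5} {1} s (((s.putBit 1 i true).putReal 4 0 (I.f {i})).putReal 5 0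
      (I.f {i} - I.c i)) :=
    ((Frame.refl.putBit (by simp) _ _).putReal (by simp) _ _).putReal (by simp) _ _
  have hag : (((s.putBit 1 i true).putReal 4 0 (I.f {i})).putReal 5 0
      (I.f {i} - I.c i)).agents n 1 = {i} := by
    simp [putBit_agents_true, h.work]
  have hr4 : (((s.putBit 1 i true).putReal 4 0 (I.f {i})).putReal 5 0
      (I.f {i} - I.c i)).real 4 0 = I.f {i} := by simp
  have hr5 : (((s.putBit 1 i true).putReal 4 0 (I.f {i})).putReal 5 0
      (I.f {i} - I.c i)).real 5 0 = I.f {i} - I.c i := by simp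
  simp only [startSingle, Program.wp, RealExpr.eval, IdxExpr.eval, h.counter, putBit_agents_true,
    h.work, putReal_real, putBit_real, putReal_idx, putBit_idx, h.sound.cost, insert_empty_eq]
  norm_num only [true_and, false_and, if_true, if_false]
  generalize ((s.putBit 1 i true).putReal 4 0 (I.f {i})).putReal 5 0 (I.f {i} - I.c i) = s₁ at *
  have hs₁ : Sound I s₁ := h.sound.of_frame hF (by simp) (by simp) (by simp) (by simp)
  refine halts_seq (T₁ := n * 20 + 30) (T₂ := 30) ((halts_keepBest hs₁ (by rw [hag]; exact Setting.feasible_single i)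
    (by rw [hag, hr5, Setting.utility_single])).mono le_rfl ?_)
  rintro s₂ ⟨hs₂, hF₂, hb, hb'⟩
  refine Program.wp.halts ?_
    (by simp [finishSingle, Program.bound, RealExpr.cost, IdxExpr.cost, Test.cost])
  have hi2 : s₂.idx 2 = i := by rw [hF₂.idx 2 (by simp), hF.idx 2 (by simp), h.counter]
  have h4 : s₂.real 4 0 = I.f {i} := by rw [hF₂.real 4 (by simp), hr4]
  have h2 : s₂.real 2 0 = s.real 2 0 := by rw [hF₂.real 2 (by simp), hF.real 2 (by simp)]
  have hA : s₂.agents n 2 = s.agents n 2 := by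
    rw [hF₂.agents 2 (by simp), hF.agents 2 (by simp)]
  have hW : s₂.agents n 1 = {i} := by rw [hF₂.agents 1 (by simp), hag]
  have hb1 : s.real 1 0 ≤ s₂.real 1 0 := by rw [← hF.real 1 (by simp)]; exact hb
  have hb2 : I.f {i} - I.c i ≤ s₂.real 1 0 := by rw [← hr5]; exact hb'
  have hsingle : ∀ j : Fin n, (j : ℕ) < i + 1 → I.f {j} - I.c j ≤ s₂.real 1 0 := by
    intro j hj
    rcases Nat.lt_succ_iff_lt_or_eq.1 hj with hj | hj
    · exact (h.single_le j hj).trans hb1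
    · obtain rfl : j = i := Fin.ext hj
      exact hb2
  have hlast : ∀ j : Fin n, j ≠ i → ((j : ℕ) < i + 1 ↔ (j : ℕ) < i) := by
    intro j hj
    have : (j : ℕ) ≠ i := fun h' => hj (Fin.ext h')
    omega
  have hmax : s.real 2 0 ≤ 2 * s₂.real 1 0 := h.max_le.trans (by linarith)
  have hsound : ∀ {s'}, Frame n {2} {2} {1, 2} s₂ s' → Sound I s' := fun h' =>
    hs₂.of_frame h' (by simp) (by simp) (by simp) (by simp)
  have hF₃ : Frame n {2} {2} {1, 2} s₂ (s₂.putBit 1 i false) := Frame.refl.putBit (by simp) _ _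
  simp only [finishSingle, Program.wp, Test.Holds, RealExpr.eval, IdxExpr.eval, hi2, hs₂.cost,
    putBit_real, putReal_idx, putBit_idx, h4, h2]
  norm_num only [true_and, false_and, if_true, if_false]
  refine ⟨fun hc => ?_, fun hc => ?_⟩
  · have hcheap : i ∈ I.cheap := Setting.mem_cheap.2 hc
    have hA' : ∀ j : Fin n, j ∈ insert i (s.agents n 2) ↔ (j : ℕ) < i + 1 ∧ j ∈ I.cheap := by
      intro j
      by_cases hj : j = i
      · subst hj; simp [hcheap]
      · simp [hj, h.cheap j, hlast j hj]
    refine ⟨fun hm => ?_, fun hm => ?_⟩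
    · constructor
      · exact hsound ((hF₃.putBit (by simp) _ _).putIdx (by simp) _)
      · simp
      · simp [putBit_agents_of_ne, putBit_agents_false, hW]
      · simpa [putBit_agents_of_ne, putBit_agents_true, hA] using hA'
      · simpa [putBit_agents_of_ne, putBit_agents_true, hA, h2, hm] using h.le_max
      · simpa [h2] using h.max_nonneg
      · simpa [h2] using hmax
      · simpa using hsingle
    · rw [not_le] at hm
      constructor
      · exact hsound (((hF₃.putBit (by simp) _ _).putReal (by simp) _ _).putIdx (by simp) _)
      · simp
      · simp [putBit_agents_of_ne, putBit_agents_false, hW]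
      · simpa [putBit_agents_of_ne, putBit_agents_true, hA] using hA'
      · simpa [putBit_agents_of_ne, putBit_agents_true, hA] using
          fun j hj => (h.le_max j hj).trans hm.le
      · simpa using (I.f_single_pos i).le
      -- A cheap agent satisfies f({i}) ≤ 2(f({i}) - c_i), at most twice the best utility so far.
      · simp only [putIdx_real, putReal_real, putBit_real]
        norm_num
        linarith
      · simpa using hsingle
  · constructor
    · exact hsound (hF₃.putIdx (by simp) _)
    · simp
    · simp [putBit_agents_false, hW]
    · intro j
      rw [putIdx_agents, putBit_agents_of_ne _ (by simp), hA, h.cheap]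
      by_cases hj : j = i
      · subst hj; simp [Setting.mem_cheap, hc]
      · rw [hlast j hj]
    · simpa [putBit_agents_of_ne, hA, h2] using h.le_max
    · simpa [h2] using h.max_nonneg
    · simpa [h2] using hmax
    · simpa using hsingle

/-- Invariant of the loop over the guessed values. -/
structure GuessInv (I : Setting n) (k : ℕ) (s : State) : Prop where
  sound : Sound I s
  counter : s.idx 2 = k
  cheap : s.agents n 2 = I.cheap
  le_max : ∀ i ∈ I.cheap, I.f {i} ≤ s.real 2 0
  max_nonneg : 0 ≤ s.real 2 0
  max_le : s.real 2 0 ≤ 2 * s.real 1 0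
  single_le : ∀ i : Fin n, I.f {i} - I.c i ≤ s.real 1 0
  guess : s.real 3 0 = (32 + k) * s.real 2 0
  guess_le : ∀ j < k, ∀ R, I.Feasible R → R ⊆ I.cheap → (32 + j) * s.real 2 0 ≤ I.f R →
    (32 + j) * s.real 2 0 ≤ 128 * s.real 1 0

theorem GuessInv.step (hf : Submodular I.f) {k : ℕ} (h : GuessInv I k s) :
    Halts I.f guessStep (n * 35 + 2 * (n * (n + 60)) + 100)
      (fun s' => s'.idx 2 = k ∧ GuessInv I (k + 1) (s'.putIdx 2 (k + 1))) s := by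
  have hk0 : (0 : ℝ) ≤ k := Nat.cast_nonneg k
  have hx32 : 32 * s.real 2 0 ≤ s.real 3 0 := by
    rw [h.guess]; nlinarith [h.max_nonneg]
  have hx0 : 0 ≤ s.real 3 0 := by linarith [h.max_nonneg]
  refine (halts_seq (T₂ := 7 + (n * 20 + 30 + 10 + 1) + 1) ((halts_passes hf h.sound h.cheap
    h.le_max h.max_nonneg hx0 rfl).mono le_rfl ?_)).mono (by omega) fun _ h => h
  rintro s₁ ⟨hF₁, hv₁, S, hadd, hdrop⟩
  refine halts_seq (Program.wp.halts ?_ (by simp [Program.bound, RealExpr.cost, IdxExpr.cost]))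
  simp only [Program.wp, RealExpr.eval, IdxExpr.eval, hv₁]
  have hF₂ : Frame n {1} {4, 5} {1} s (s₁.putReal 5 0 (I.f (s₁.agents n 1) / ((2 : ℚ) : ℝ))) :=
    hF₁.putReal (by simp) _ _
  have hag₂ : (s₁.putReal 5 0 (I.f (s₁.agents n 1) / ((2 : ℚ) : ℝ))).agents n 1 =
    s₁.agents n 1 := rfl
  have hr₂ : (s₁.putReal 5 0 (I.f (s₁.agents n 1) / ((2 : ℚ) : ℝ))).real 5 0 =
    I.f (s₁.agents n 1) / 2 := by simp
  generalize s₁.putReal 5 0 (I.f (s₁.agents n 1) / ((2 : ℚ) : ℝ)) = s₂ at *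
  obtain ⟨hfeas, hutil⟩ := hdrop.half_le_utility h.le_max hx32
  have hs₂ : Sound I s₂ := h.sound.of_frame hF₂ (by simp) (by simp) (by simp) (by simp)
  refine halts_seq (T₁ := n * 20 + 30) (T₂ := 10) ((halts_keepBest hs₂ (by rwa [hag₂]) (by rwa [hag₂, hr₂])).mono le_rfl ?_)
  rintro s₃ ⟨hs₃, hF₃, hb, hb'⟩
  refine Program.wp.halts ?_ (by simp [Program.bound, RealExpr.cost, IdxExpr.cost])
  rw [hr₂] at hb'
  rw [hF₂.real 1 (by simp)] at hb
  have hF : Frame n {1, 3} {1, 4, 5} {0, 1} s s₃ :=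
    (Frame.refl.trans hF₂ (X := {1, 3}) (R := {1, 4, 5}) (B := {0, 1})
      (by simp) (by simp) (by simp)).trans hF₃ (by simp) (by simp) (by simp)
  have hM := hF.real 2 (by simp)
  have hX := hF.real 3 (by simp)
  simp only [Program.wp, RealExpr.eval, IdxExpr.eval]
  refine ⟨by simp [hF.idx 2, h.counter], ?_⟩
  constructor
  · exact hs₃.of_frame (X := {2}) (R := {3}) (B := ∅)
      ((Frame.refl.putReal (by simp) _ _).putIdx (by simp) _) (by simp) (by simp) (by simp) (by simp)
  · simp
  · simp [hF.agents 2, h.cheap]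
  · simpa [hM] using h.le_max
  · simpa [hM] using h.max_nonneg
  · simpa [hM] using h.max_le.trans (by linarith)
  · simpa using fun i => (h.single_le i).trans hb
  · simp [hM, hX, h.guess]; ring
  · intro j hj R hR hRc
    simp only [putIdx_real, putReal_real, hM]
    norm_num only [true_and, false_and, if_true, if_false]
    intro hjR
    rcases Nat.lt_succ_iff_lt_or_eq.1 hj with hj | rfl
    · linarith [h.guess_le j hj R hR hRc hjR]
    -- 128 = 32 · 2 · 2: the first pass reaches x/32, the second keeps half of it, and half of that
    -- is the stored score.
    · rw [← h.guess] at hjR ⊢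
      linarith [hadd.value hf hx0 hR hRc hjR, hdrop.value]

theorem initState_agents (c : Fin n → ℝ) (b : ℕ) : (initState c).agents n b = ∅ := by
  simp [initState, State.agents]

theorem sound_initState (I : Setting n) : Sound I (initState I.c) where
  idx := by simp [initState]
  cost i := by simp [initState]
  feasible := by simpa [initState_agents] using Setting.feasible_empty
  best := by
    rw [initState_agents, Setting.utility_empty]
    simp [initState]

/-- The time is cubic: n guesses, each with two passes over n agents, and a query of cost n + 1 for
an agent. -/
theorem halts_approxProgram (hf : Submodular I.f) :
    Halts I.f approxProgram
      (n * (n * 21 + 90) + n * (n * 35 + 2 * (n * (n + 60)) + 110) + 50)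
      (fun s => I.Feasible (s.agents n 0) ∧ I.optWelfare ≤ 468 * I.utility (s.agents n 0))
      (initState I.c) := by
  have hs := sound_initState I
  refine (halts_seq (T₂ := 7 + (n * (n * 35 + 2 * (n * (n + 60)) + 100 + 10) + 8) + 1)
    (halts_forAgents (SingleInv I) (fun k s h => ⟨h.sound.idx, h.counter⟩) ?_
      (fun k hk s h => SingleInv.step (i := ⟨k, hk⟩) h) ?_)).mono (by ring_nf; omega) fun _ h => h
  · constructor
    · exact hs.of_frame (X := {2}) (R := ∅) (B := ∅) (Frame.refl.putIdx (by simp) _) (by simp)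
        (by simp) (by simp) (by simp)
    all_goals simp [initState_agents]
    all_goals simp [initState]
  · intro s₁ h₁
    have hA : s₁.agents n 2 = I.cheap := Finset.ext fun i => by simp [h₁.cheap]
    refine halts_seq (Program.wp.halts ?_ (by simp [Program.bound, RealExpr.cost, IdxExpr.cost]))
    simp only [Program.wp, RealExpr.eval, IdxExpr.eval]
    refine halts_forAgents (GuessInv I) (fun k s h => ⟨h.sound.idx, h.counter⟩) ?_
      (fun k hk s h => h.step hf) ?_
    · constructor
      · exact h₁.sound.of_frame (X := {2}) (R := {3}) (B := ∅)
          ((Frame.refl.putReal (by simp) _ _).putIdx (by simp) _) (by simp) (by simp) (by simp) (by simp)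
      · simp
      · simpa using hA
      · simpa [hA] using h₁.le_max
      · simpa using h₁.max_nonneg
      · simpa using h₁.max_le
      · simpa using h₁.single_le
      · simp
      · simp
    · intro s₂ h₂
      refine ⟨h₂.sound.feasible, ?_⟩
      linarith [Setting.optWelfare_le hf h₂.max_nonneg h₂.le_max h₂.max_le h₂.single_le
        h₂.guess_le, h₂.sound.best]

end Correctness

end TeamContracts

theorem mainTheorem6 :
    ∃ (P : TeamContracts.Program) (p : Polynomial ℕ),
      ∀ (n : ℕ) (I : TeamContracts.Setting n), TeamContracts.Submodular I.f →
        ∃ S : Finset (Fin n),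
          TeamContracts.Outputs P I.f I.c (p.eval n) S ∧
          I.Feasible S ∧
          I.optWelfare ≤ 468 * I.utility S := by
  refine ⟨TeamContracts.approxProgram, .X * (.X * 21 + 90) +
    .X * (.X * 35 + 2 * (.X * (.X + 60)) + 110) + 50, fun n I hf => ?_⟩
  obtain ⟨t, s, ht, hr, hfeas, hopt⟩ := TeamContracts.halts_approxProgram hf
  exact ⟨_, ⟨t, s, by simpa using ht, hr, rfl⟩, hfeas, hopt⟩
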